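/- Let $d\ge 2$ and consider the lattice $\mathbb{Z}^d$ with its set $E(\mathbb{Z}^d)$ of nearest-neighbour edges. Let $G$ be a probability measure on $\mathbb{R}$ such that, for some $b>a>0$ and $\alpha>0$, $G$ is supported on $[a,b]$ and is absolutely continuous with a density $\rho$ satisfying $\rho(x)\ge\alpha$ for almost all $x\in[a,b]$. Let $(t_e)_{e\in E(\mathbb{Z}^d)}$ be independent random weights with distribution $G$. The passage time of a finite lattice path $p$ is $T(p)=\sum_{e\in p}t_e$ (each traversal of an edge is counted), and a geodesic between $u,v\in\mathbb{Z}^d$ is a path from $u$ to $v$ whose passage time is minimal among all finite paths from $u$ to $v$. Then, almost surely, for all $u,v\in\mathbb{Z}^d$ there is a unique geodesic $\gamma(u,v)$ from $u$ to $v$. Moreover, for every $\epsilon>0$ there is a constant $C_\epsilon>0$, depending only on $d$, $G$ and $\epsilon$, such that for all $v\in\mathbb{Z}^d$, $$\big|\{e\in E(\mathbb{Z}^d):\ \mathbb{P}(e\in\gamma(0,v))\ge\epsilon\}\big|\le C_\epsilon .$$ -/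

import Mathlib

open MeasureTheory

namespace FPP

/-- The nearest-neighbour graph on `ℤ^d`: two vertices are adjacent when their `ℓ¹` distance
is one. -/
def lattice (d : ℕ) : SimpleGraph (Fin d → ℤ) where
  Adj u v := ∑ i, |u i - v i| = 1
  symm := ⟨fun u v h => by simpa only [abs_sub_comm] using h⟩
  loopless := ⟨fun u h => by simp at h⟩

/-- The (undirected) edges `E(ℤ^d)`. -/
abbrev Edge (d : ℕ) : Type := (lattice d).edgeSet

/-- The passage time `T(p) = ∑_{e ∈ p} t_e` of a finite lattice path `p` in the environment `t`.
An edge that is used several times is counted each time. -/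
def pathTime {d : ℕ} (t : Edge d → ℝ) : {u v : Fin d → ℤ} → (lattice d).Walk u v → ℝ
  | _, _, .nil => 0
  | _, _, .cons (u := u) (v := w) h p =>
      t ⟨s(u, w), (SimpleGraph.mem_edgeSet (lattice d)).2 h⟩ + pathTime t p

/-- A path from `u` to `v` is a geodesic when its passage time attains the infimum of the passage
times of all finite paths from `u` to `v`. -/
def IsGeodesic {d : ℕ} (t : Edge d → ℝ) {u v : Fin d → ℤ} (p : (lattice d).Walk u v) : Prop :=
  ∀ q : (lattice d).Walk u v, pathTime t p ≤ pathTime t q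

/-- The edges that lie on a geodesic between `u` and `v`. When the geodesic `γ(u, v)` is unique,
this is its set of edges. -/
def geodesicEdges {d : ℕ} (t : Edge d → ℝ) (u v : Fin d → ℤ) : Set (Edge d) :=
  {e | ∃ p : (lattice d).Walk u v, IsGeodesic t p ∧ (e : Sym2 (Fin d → ℤ)) ∈ p.edges}

/-- The law of the environment `(t_e)`: independent weights, each with distribution `G`. -/
noncomputable def envMeasure (d : ℕ) (G : Measure ℝ) [IsProbabilityMeasure G] :
    Measure (Edge d → ℝ) :=
  Measure.infinitePi fun _ : Edge d => G

/-- For some `0 < a < b` and `α > 0`, the measure `G` is supported on `[a, b]` and is absolutely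
continuous, with a density that is at least `α` almost everywhere on `[a, b]`. -/
def WeightAssumption (G : Measure ℝ) : Prop :=
  ∃ a b α : ℝ, 0 < a ∧ a < b ∧ 0 < α ∧ G (Set.Icc a b)ᶜ = 0 ∧
    ∃ ρ : ℝ → ENNReal, Measurable ρ ∧ G = volume.withDensity ρ ∧
      ∀ᵐ x : ℝ, x ∈ Set.Icc a b → ENNReal.ofReal α ≤ ρ x

end FPP

/-!
Write `T(u, v)` for the passage time and `f(e)` for the covariance of `T(0, v)` with the weight
`t_e`.

Uniqueness of geodesics: two distinct paths with the same endpoints differ in an edge, and given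
the other weights, only one value of the weight of that edge makes their passage times equal
(`ae_pathTime_ne`).

The bound on the number of influential edges compares `f` with its translates.

* Resampling a single weight shows that `f(e)` is comparable to `P(e ∈ γ(0, v))`: it is at most a
  constant times this probability (`edgeCov_le`), and it is bounded below in terms of it
  (`le_edgeCov`). So it is enough to bound the number of edges with `f(e) ≥ κ`.
* The difference `T(0, v) - T(x, x + v)` is at most `2 b |x|₁` in absolute value, and its covariance
  with `t_e` is `f(e) - f(e - x)`. The centred weights are orthogonal, so Bessel's inequality
  (`sum_sq_integral_mul_sub_mean_le`) gives `∑ₑ (f(e) - f(e - x))² ≤ C |x|²`, uniformly in `v`.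
* A geodesic visits a box of side `r` at most `C r` times (`IsGeodesic.countP_support_le`), while the
  box has `r ^ d` points. As `d ≥ 2`, for `r` large the average of `f(e - x)` over `x` in a box of side
  `r` is at most `κ / 2`, for every edge `e` (`sum_edgeCov_translates_le`).

Hence an edge with `f(e) ≥ κ` contributes at least `κ² / 4` to the average over `x` in the box of
`∑ₑ (f(e) - f(e - x))²`, which is at most `C r²`, and the number of such edges is bounded
(`exists_card_le_of_le_edgeCov`).
-/

namespace FPP

variable {d : ℕ}

/-! ### Passage times of walks -/

instance countable_walk (u v : Fin d → ℤ) : Countable ((lattice d).Walk u v) :=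
  Function.Injective.countable (f := fun p : (lattice d).Walk u v => p.support)
    fun _ _ h => SimpleGraph.Walk.ext_support h

@[simp] lemma pathTime_nil (t : Edge d → ℝ) (u : Fin d → ℤ) :
    pathTime t (.nil : (lattice d).Walk u u) = 0 := rfl

lemma pathTime_cons (t : Edge d → ℝ) {u v w : Fin d → ℤ} (h : (lattice d).Adj u w)
    (p : (lattice d).Walk w v) :
    pathTime t (.cons h p) =
      t ⟨s(u, w), (SimpleGraph.mem_edgeSet (lattice d)).2 h⟩ + pathTime t p := rfl

lemma pathTime_append (t : Edge d → ℝ) {u v w : Fin d → ℤ} (p : (lattice d).Walk u v)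
    (q : (lattice d).Walk v w) : pathTime t (p.append q) = pathTime t p + pathTime t q := by
  induction p with
  | nil => simp
  | cons h p ih => simp [pathTime_cons, ih, add_assoc]

lemma mul_length_le_pathTime {t : Edge d → ℝ} {a : ℝ} (ht : ∀ e, a ≤ t e) {u v : Fin d → ℤ}
    (p : (lattice d).Walk u v) : a * p.length ≤ pathTime t p := by
  induction p with
  | nil => simp
  | cons h p ih =>
    rw [pathTime_cons, SimpleGraph.Walk.length_cons]
    push_cast
    linarith [ht ⟨_, (SimpleGraph.mem_edgeSet (lattice d)).2 h⟩]

lemma pathTime_le_mul_length {t : Edge d → ℝ} {b : ℝ} (ht : ∀ e, t e ≤ b) {u v : Fin d → ℤ}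
    (p : (lattice d).Walk u v) : pathTime t p ≤ b * p.length := by
  induction p with
  | nil => simp
  | cons h p ih =>
    rw [pathTime_cons, SimpleGraph.Walk.length_cons]
    push_cast
    linarith [ht ⟨_, (SimpleGraph.mem_edgeSet (lattice d)).2 h⟩]

lemma pathTime_nonneg {t : Edge d → ℝ} (ht : ∀ e, 0 ≤ t e) {u v : Fin d → ℤ}
    (p : (lattice d).Walk u v) : 0 ≤ pathTime t p := by
  simpa using mul_length_le_pathTime ht p

/-- The passage time of a fixed walk is affine in each single weight, with slope the number of
traversals of that edge. -/
lemma pathTime_update (t : Edge d → ℝ) (e : Edge d) (s : ℝ) {u v : Fin d → ℤ}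
    (p : (lattice d).Walk u v) :
    pathTime (Function.update t e s) p =
      pathTime (Function.update t e 0) p + s * (p.edges.count (e : Sym2 (Fin d → ℤ))) := by
  induction p with
  | nil => simp
  | @cons x y z h p ih =>
    rw [pathTime_cons, pathTime_cons, ih, SimpleGraph.Walk.edges_cons, List.count_cons]
    by_cases hxy : (⟨s(x, y), (SimpleGraph.mem_edgeSet (lattice d)).2 h⟩ : Edge d) = e
    · subst hxy
      simp
      ring
    · have : ¬ (s(x, y) = (e : Sym2 (Fin d → ℤ))) := fun h' => hxy (Subtype.ext h')
      simp [hxy, this]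
      ring

lemma pathTime_update_sub (t : Edge d → ℝ) (e : Edge d) (s s' : ℝ) {u v : Fin d → ℤ}
    (p : (lattice d).Walk u v) :
    pathTime (Function.update t e s) p = pathTime (Function.update t e s') p +
      (s - s') * (p.edges.count (e : Sym2 (Fin d → ℤ))) := by
  rw [pathTime_update t e s, pathTime_update t e s']
  ring

lemma measurable_pathTime {u v : Fin d → ℤ} (p : (lattice d).Walk u v) :
    Measurable fun t : Edge d → ℝ => pathTime t p := by
  induction p with
  | nil => exact measurable_const
  | cons h p ih => exact (measurable_pi_apply _).add ih

lemma measurableSet_isGeodesic {u v : Fin d → ℤ} (p : (lattice d).Walk u v) :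
    MeasurableSet {t : Edge d → ℝ | IsGeodesic t p} := by
  simp only [IsGeodesic, Set.ofPred_forall]
  exact .iInter fun q => measurableSet_le (measurable_pathTime p) (measurable_pathTime q)

lemma measurableSet_mem_geodesicEdges (e : Edge d) (u v : Fin d → ℤ) :
    MeasurableSet {t : Edge d → ℝ | e ∈ geodesicEdges t u v} := by
  have : {t : Edge d → ℝ | e ∈ geodesicEdges t u v} =
      ⋃ p : (lattice d).Walk u v, {t | IsGeodesic t p} ∩ {_t | (e : Sym2 (Fin d → ℤ)) ∈ p.edges} := by
    ext t
    simp [geodesicEdges]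
  rw [this]
  exact .iUnion fun p => (measurableSet_isGeodesic p).inter (.const _)

/-! ### Walks of bounded length -/

/-- The `ℓ¹` norm on `ℤ^d`. -/
def l1 (x : Fin d → ℤ) : ℤ := ∑ i, |x i|

lemma exists_walk_length_eq (u v : Fin d → ℤ) :
    ∃ p : (lattice d).Walk u v, (p.length : ℤ) = l1 (v - u) := by
  obtain ⟨n, hn⟩ : ∃ n : ℕ, (n : ℤ) = l1 (v - u) :=
    ⟨(l1 (v - u)).toNat, Int.toNat_of_nonneg (Finset.sum_nonneg fun i _ => abs_nonneg _)⟩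
  induction n generalizing u with
  | zero =>
    have h : ∀ i, |(v - u) i| = 0 := by
      have := (Finset.sum_eq_zero_iff_of_nonneg (s := Finset.univ)
        (f := fun i => |(v - u) i|) fun i _ => abs_nonneg _).1 (by simpa [l1] using hn.symm)
      exact fun i => this i (Finset.mem_univ i)
    obtain rfl : u = v := by
      funext i
      have := h i
      simp [sub_eq_zero] at this
      exact this.symm
    exact ⟨.nil, by simp [l1]⟩
  | succ n ih =>
    obtain ⟨i, hi⟩ : ∃ i, (v - u) i ≠ 0 := by
      by_contra! h
      simp only [l1, h] at hn
      simp at hn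
      omega
    -- Step along the coordinate `i` towards `v`.
    let w : Fin d → ℤ := Function.update u i (u i + SignType.sign ((v - u) i))
    have hs : |((SignType.sign ((v - u) i) : SignType) : ℤ)| = 1 := by
      rcases lt_or_gt_of_ne hi with h | h
      · rw [sign_neg h]; rfl
      · rw [sign_pos h]; rfl
    have hadj : (lattice d).Adj u w := by
      change ∑ j, |u j - w j| = 1
      rw [Finset.sum_eq_single i]
      · simp only [w, Function.update_self, sub_add_cancel_left, abs_neg]
        exact hs
      · intro j _ hj
        simp [w, hj]
      · simp
    have hw : l1 (v - w) + 1 = l1 (v - u) := by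
      unfold l1
      rw [← Finset.add_sum_erase _ _ (Finset.mem_univ i),
        ← Finset.add_sum_erase _ (fun j => |(v - u) j|) (Finset.mem_univ i)]
      have h1 : ∑ j ∈ Finset.univ.erase i, |(v - w) j| = ∑ j ∈ Finset.univ.erase i, |(v - u) j| := by
        refine Finset.sum_congr rfl fun j hj => ?_
        simp [w, Finset.ne_of_mem_erase hj]
      have h2 : |(v - w) i| + 1 = |(v - u) i| := by
        simp only [w, Pi.sub_apply, Function.update_self] at hi ⊢
        rcases lt_or_gt_of_ne hi with h | h
        · rw [sign_neg h, abs_of_neg h, abs_of_nonpos] <;> simp <;> omega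
        · rw [sign_pos h, abs_of_pos h, abs_of_nonneg] <;> simp <;> omega
      rw [h1]
      linarith
    obtain ⟨p, hp⟩ := ih w (by push_cast at hn; linarith)
    exact ⟨.cons hadj p, by simp [hp, hw]⟩

lemma l1_sub_le_length {u v : Fin d → ℤ} (p : (lattice d).Walk u v) :
    l1 (v - u) ≤ p.length := by
  induction p with
  | nil => simp [l1]
  | @cons x y z h p ih =>
    have h' : ∑ i, |x i - y i| = 1 := h
    have : l1 (z - x) ≤ l1 (z - y) + ∑ i, |x i - y i| := by
      unfold l1
      rw [← Finset.sum_add_distrib]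
      refine Finset.sum_le_sum fun i _ => ?_
      have := abs_sub_le (z i) (y i) (x i)
      rwa [abs_sub_comm (y i)] at this
    rw [SimpleGraph.Walk.length_cons]
    push_cast
    linarith

lemma finite_walk_length_le (u v : Fin d → ℤ) (n : ℕ) :
    {p : (lattice d).Walk u v | p.length ≤ n}.Finite := by
  have hfin : (Set.Icc (fun i => u i - n) (fun i => u i + n) : Set (Fin d → ℤ)).Finite :=
    Set.finite_Icc _ _
  have hlist : {l : List (Fin d → ℤ) | (∀ x ∈ l, x ∈ Set.Icc (fun i => u i - n) (fun i => u i + n)) ∧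
      l.length ≤ n + 1}.Finite := by
    have := hfin.to_subtype
    refine ((List.finite_length_le
      (Set.Icc (fun i => u i - n) (fun i => u i + n) : Set (Fin d → ℤ)) (n + 1)).image
      (List.map Subtype.val)).subset ?_
    rintro l ⟨hl, hn⟩
    lift l to List (Set.Icc (fun i => u i - n) (fun i => u i + n) : Set (Fin d → ℤ)) using hl
    exact ⟨l, by simpa using hn, rfl⟩
  refine Set.Finite.of_finite_image (f := fun p => p.support) (hlist.subset ?_)
    fun _ _ _ _ h => SimpleGraph.Walk.ext_support h
  rintro _ ⟨p, hp, rfl⟩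
  have hp : p.length ≤ n := hp
  refine ⟨fun x hx => ?_, by simpa using hp⟩
  have h1 := l1_sub_le_length (p.takeUntil x hx)
  have h2 := p.length_takeUntil_le_length hx
  have h3 (i) : |x i - u i| ≤ n := by
    have := Finset.single_le_sum (f := fun i => |(x - u) i|) (fun i _ => abs_nonneg _)
      (Finset.mem_univ i)
    simp only [Pi.sub_apply] at this
    have : |x i - u i| ≤ l1 (x - u) := this
    omega
  constructor <;> intro i <;> have := abs_le.1 (h3 i) <;> simp only <;> omega

/-! ### Geodesics in a fixed environment -/

lemma exists_isGeodesic {t : Edge d → ℝ} {a : ℝ} (ha : 0 < a) (ht : ∀ e, a ≤ t e)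
    (u v : Fin d → ℤ) : ∃ p : (lattice d).Walk u v, IsGeodesic t p := by
  obtain ⟨p₀, -⟩ := exists_walk_length_eq u v
  have hfin : {p : (lattice d).Walk u v | pathTime t p ≤ pathTime t p₀}.Finite := by
    refine (finite_walk_length_le u v ⌊pathTime t p₀ / a⌋₊).subset fun p hp => ?_
    refine Nat.le_floor ?_
    rw [le_div_iff₀ ha, mul_comm]
    exact (mul_length_le_pathTime ht p).trans hp
  obtain ⟨p, hp, hmin⟩ := hfin.exists_minimalFor (fun p => pathTime t p) _ ⟨p₀, le_refl (pathTime t p₀)⟩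
  refine ⟨p, fun q => ?_⟩
  by_cases hq : pathTime t q ≤ pathTime t p₀
  · exact (le_total _ _).elim id fun h => hmin hq h
  · exact le_trans hp (not_le.1 hq).le

/-- The first passage time `T(u, v)`: the infimum of the passage times of the walks from `u`
to `v`. -/
noncomputable def passageTime (t : Edge d → ℝ) (u v : Fin d → ℤ) : ℝ :=
  ⨅ p : (lattice d).Walk u v, pathTime t p

lemma IsGeodesic.passageTime_eq {t : Edge d → ℝ} {u v : Fin d → ℤ} {p : (lattice d).Walk u v}
    (hp : IsGeodesic t p) : passageTime t u v = pathTime t p :=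
  have : IsLeast (Set.range fun q : (lattice d).Walk u v => pathTime t q) (pathTime t p) :=
    ⟨⟨p, rfl⟩, by rintro _ ⟨q, rfl⟩; exact hp q⟩
  this.csInf_eq

lemma passageTime_le {t : Edge d → ℝ} (ht : ∀ e, 0 ≤ t e) {u v : Fin d → ℤ}
    (p : (lattice d).Walk u v) : passageTime t u v ≤ pathTime t p :=
  ciInf_le ⟨0, by rintro _ ⟨q, rfl⟩; exact pathTime_nonneg ht q⟩ p

lemma passageTime_nonneg {t : Edge d → ℝ} (ht : ∀ e, 0 ≤ t e) (u v : Fin d → ℤ) :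
    0 ≤ passageTime t u v :=
  Real.iInf_nonneg fun p => pathTime_nonneg ht p

lemma measurable_passageTime (u v : Fin d → ℤ) :
    Measurable fun t : Edge d → ℝ => passageTime t u v :=
  .iInf fun p => measurable_pathTime p

lemma passageTime_le_l1 {t : Edge d → ℝ} {b : ℝ} (ht : ∀ e, t e ∈ Set.Icc 0 b)
    (u v : Fin d → ℤ) : passageTime t u v ≤ b * l1 (v - u) := by
  obtain ⟨p, hp⟩ := exists_walk_length_eq u v
  refine (passageTime_le (fun e => (ht e).1) p).trans ?_
  rw [← hp]
  exact_mod_cast pathTime_le_mul_length (fun e => (ht e).2) p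

lemma passageTime_triangle {t : Edge d → ℝ} {a : ℝ} (ha : 0 < a) (ht : ∀ e, a ≤ t e)
    (u v w : Fin d → ℤ) : passageTime t u w ≤ passageTime t u v + passageTime t v w := by
  obtain ⟨p, hp⟩ := exists_isGeodesic ha ht u v
  obtain ⟨q, hq⟩ := exists_isGeodesic ha ht v w
  rw [hp.passageTime_eq, hq.passageTime_eq, ← pathTime_append]
  exact passageTime_le (fun e => ha.le.trans (ht e)) _

lemma abs_passageTime_sub_translate_le {t : Edge d → ℝ} {a b : ℝ} (ha : 0 < a)
    (ht : ∀ e, t e ∈ Set.Icc a b) (v x : Fin d → ℤ) :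
    |passageTime t 0 v - passageTime t x (x + v)| ≤ 2 * b * l1 x := by
  have ht' : ∀ e, t e ∈ Set.Icc 0 b := fun e => ⟨ha.le.trans (ht e).1, (ht e).2⟩
  have hl : l1 (-x) = l1 x := by simp [l1]
  have h1 := passageTime_triangle ha (fun e => (ht e).1) 0 x v
  have h2 := passageTime_triangle ha (fun e => (ht e).1) x (x + v) v
  have h3 := passageTime_triangle ha (fun e => (ht e).1) x 0 (x + v)
  have h4 := passageTime_triangle ha (fun e => (ht e).1) 0 v (x + v)
  have k1 := passageTime_le_l1 ht' 0 x
  have k2 := passageTime_le_l1 ht' x 0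
  have k3 := passageTime_le_l1 ht' v (x + v)
  have k4 := passageTime_le_l1 ht' (x + v) v
  simp only [sub_zero, zero_sub, add_sub_cancel_right, sub_add_cancel_right, hl] at k1 k2 k3 k4
  rw [abs_le]
  constructor <;> linarith

lemma IsGeodesic.of_append_left {t : Edge d → ℝ} {u v w : Fin d → ℤ}
    {p : (lattice d).Walk u v} {q : (lattice d).Walk v w} (h : IsGeodesic t (p.append q)) :
    IsGeodesic t p := fun r => by
  simpa [pathTime_append] using h (r.append q)

lemma IsGeodesic.of_append_right {t : Edge d → ℝ} {u v w : Fin d → ℤ}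
    {p : (lattice d).Walk u v} {q : (lattice d).Walk v w} (h : IsGeodesic t (p.append q)) :
    IsGeodesic t q := fun r => by
  simpa [pathTime_append] using h (p.append r)

lemma IsGeodesic.isPath {t : Edge d → ℝ} (ht : ∀ e, 0 < t e) {u v : Fin d → ℤ}
    {p : (lattice d).Walk u v} (hp : IsGeodesic t p) : p.IsPath := by
  induction p with
  | nil => exact .nil
  | @cons x y z h p ih =>
    have hg : IsGeodesic t p :=
      IsGeodesic.of_append_right (p := .cons h .nil) (by simpa using hp)
    refine (SimpleGraph.Walk.cons_isPath_iff h p).2 ⟨ih hg, fun hx => ?_⟩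
    -- If `x` is visited again, cutting out the loop saves the first edge.
    have h1 := hp (p.dropUntil x hx)
    rw [pathTime_cons] at h1
    have h2 : pathTime t p = pathTime t (p.takeUntil x hx) + pathTime t (p.dropUntil x hx) := by
      rw [← pathTime_append, SimpleGraph.Walk.take_spec]
    linarith [ht ⟨_, (SimpleGraph.mem_edgeSet (lattice d)).2 h⟩,
      pathTime_nonneg (fun e => (ht e).le) (p.takeUntil x hx)]

/-- A path is determined by its set of edges; more precisely, no path is properly contained in
another path with the same endpoints. -/
lemma eq_of_edges_subset {u v : Fin d → ℤ} {p q : (lattice d).Walk u v} (hp : p.IsPath)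
    (hq : q.IsPath) (h : ∀ e ∈ p.edges, e ∈ q.edges) : p = q := by
  induction p with
  | nil => exact (SimpleGraph.Walk.isPath_iff_nil.1 hq).eq_nil.symm
  | @cons x y z hxy p ih =>
    cases q with
    | nil => exact absurd (h s(x, y) (by simp)) (by simp)
    | @cons _ y' _ hxy' q =>
      rw [SimpleGraph.Walk.cons_isPath_iff] at hp hq
      obtain rfl : y = y' := by
        have := h s(x, y) (by simp)
        rw [SimpleGraph.Walk.edges_cons, List.mem_cons] at this
        rcases this with h' | h'
        · exact Sym2.congr_right.1 h'
        · exact (hq.2 (q.fst_mem_support_of_mem_edges h')).elim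
      congr 1
      refine ih hp.1 hq.1 fun e he => ?_
      have := h e (by simp [he])
      rw [SimpleGraph.Walk.edges_cons, List.mem_cons] at this
      rcases this with rfl | h'
      · exact (hp.2 (p.fst_mem_support_of_mem_edges he)).elim
      · exact h'

open Classical in
/-- A walk that visits a set `S` at `n ≥ 1` steps has an initial segment that ends in `S` and
has at least `n - 1` edges, hence passage time at least `a * (n - 1)`. -/
lemma exists_append_of_countP_pos {t : Edge d → ℝ} {a : ℝ} (ha : 0 ≤ a) (ht : ∀ e, a ≤ t e)
    (S : Set (Fin d → ℤ)) {u v : Fin d → ℤ} (p : (lattice d).Walk u v)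
    (hn : 0 < p.support.countP (· ∈ S)) :
    ∃ w ∈ S, ∃ (q : (lattice d).Walk u w) (r : (lattice d).Walk w v), p = q.append r ∧
      a * (p.support.countP (· ∈ S) - 1) ≤ pathTime t q := by
  induction p with
  | @nil u =>
    have hu : u ∈ S := by
      by_contra hu
      simp [hu] at hn
    exact ⟨u, hu, .nil, .nil, by simp, by simp [hu]⟩
  | @cons x y z h p ih =>
    rw [SimpleGraph.Walk.support_cons, List.countP_cons] at hn ⊢
    by_cases hp : 0 < p.support.countP (· ∈ S)
    · obtain ⟨w, hw, q, r, hqr, hq⟩ := ih hp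
      refine ⟨w, hw, .cons h q, r, by simp [hqr], ?_⟩
      rw [pathTime_cons]
      have h1 := ht ⟨_, (SimpleGraph.mem_edgeSet (lattice d)).2 h⟩
      split_ifs <;> push_cast <;> nlinarith
    · have hp0 : p.support.countP (· ∈ S) = 0 := by omega
      have hx : x ∈ S := by
        by_contra hx
        simp [hp0, hx] at hn
      exact ⟨x, hx, .nil, .cons h p, by simp, by simp [hp0, hx]⟩

open Classical in
/-- A geodesic visits a set of `T`-diameter at most `R` at most `R / a + 1` times, since the
part of it between the first and the last visit is a geodesic too. -/
lemma IsGeodesic.countP_support_le {t : Edge d → ℝ} {a R : ℝ} (ha : 0 < a) (ht : ∀ e, a ≤ t e)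
    (hR : 0 ≤ R) {S : Set (Fin d → ℤ)} (hS : ∀ x ∈ S, ∀ y ∈ S, passageTime t x y ≤ R)
    {u v : Fin d → ℤ} {p : (lattice d).Walk u v} (hp : IsGeodesic t p) :
    (p.support.countP (· ∈ S) : ℝ) ≤ R / a + 1 := by
  have key {u v : Fin d → ℤ} {p : (lattice d).Walk u v} (hp : IsGeodesic t p) (hu : u ∈ S) :
      (p.support.countP (· ∈ S) : ℝ) ≤ R / a + 1 := by
    obtain ⟨w, hw, q, r, rfl, hq⟩ := exists_append_of_countP_pos ha.le ht S p
      (List.countP_pos_iff.2 ⟨u, p.start_mem_support, by simpa using hu⟩)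
    rw [← hp.of_append_left.passageTime_eq] at hq
    have := hq.trans (hS u hu w hw)
    rw [← sub_le_iff_le_add, le_div_iff₀ ha]
    linarith
  induction p with
  | @nil u =>
    by_cases hu : u ∈ S
    · exact key hp hu
    · simp [hu]
      positivity
  | @cons x y z h p ih =>
    by_cases hx : x ∈ S
    · exact key hp hx
    · have := ih (IsGeodesic.of_append_right (p := .cons h .nil) (by simpa using hp))
      simpa [hx] using this

/-! ### Dependence of the passage time on a single weight -/

lemma update_mem_Icc {t : Edge d → ℝ} {a b s : ℝ} (ht : ∀ e, t e ∈ Set.Icc a b)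
    (hs : s ∈ Set.Icc a b) (e e' : Edge d) : Function.update t e s e' ∈ Set.Icc a b := by
  by_cases h : e' = e
  · subst h; simpa using hs
  · simpa [h] using ht e'

section SingleWeight

variable {t : Edge d → ℝ} {a b s s' : ℝ} {e : Edge d} {u v : Fin d → ℤ}

/-- Lowering the weight of an edge on a geodesic lowers the passage time by at least the same
amount. -/
lemma passageTime_update_add_sub_le (ha : 0 < a) (ht : ∀ e, t e ∈ Set.Icc a b)
    (hs' : s' ∈ Set.Icc a b) (hss : s' ≤ s)
    (he : e ∈ geodesicEdges (Function.update t e s) u v) :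
    passageTime (Function.update t e s') u v + (s - s') ≤
      passageTime (Function.update t e s) u v := by
  obtain ⟨p, hp, hep⟩ := he
  have h1 := passageTime_le (fun e' => ha.le.trans (update_mem_Icc ht hs' e e').1) p
  have h2 : (1 : ℝ) ≤ p.edges.count (e : Sym2 (Fin d → ℤ)) := by
    exact_mod_cast List.count_pos_iff.2 hep
  rw [hp.passageTime_eq, pathTime_update_sub t e s s']
  nlinarith

lemma passageTime_update_mono (ha : 0 < a) (ht : ∀ e, t e ∈ Set.Icc a b)
    (hs : s ∈ Set.Icc a b) (hs' : s' ∈ Set.Icc a b) (hss : s' ≤ s) :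
    passageTime (Function.update t e s') u v ≤ passageTime (Function.update t e s) u v := by
  obtain ⟨p, hp⟩ := exists_isGeodesic ha (fun e' => (update_mem_Icc ht hs e e').1) u v
  have h1 := passageTime_le (fun e' => ha.le.trans (update_mem_Icc ht hs' e e').1) p
  rw [hp.passageTime_eq, pathTime_update_sub t e s s']
  have : 0 ≤ (s - s') * (p.edges.count (e : Sym2 (Fin d → ℤ)) : ℝ) :=
    mul_nonneg (by linarith) (Nat.cast_nonneg _)
  linarith

open Classical in
/-- Raising the weight of an edge raises the passage time by at most the same amount, and not at
all when the edge is not on a geodesic. -/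
lemma passageTime_update_le_add (ha : 0 < a) (ht : ∀ e, t e ∈ Set.Icc a b)
    (hs : s ∈ Set.Icc a b) (hs' : s' ∈ Set.Icc a b) (hss : s' ≤ s) :
    passageTime (Function.update t e s) u v ≤ passageTime (Function.update t e s') u v +
      (s - s') * (if e ∈ geodesicEdges (Function.update t e s') u v then 1 else 0) := by
  obtain ⟨p, hp⟩ := exists_isGeodesic ha (fun e' => (update_mem_Icc ht hs' e e').1) u v
  have h1 := passageTime_le (fun e' => ha.le.trans (update_mem_Icc ht hs e e').1) p
  rw [pathTime_update_sub t e s s'] at h1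
  rw [hp.passageTime_eq]
  refine h1.trans (add_le_add_right (mul_le_mul_of_nonneg_left ?_ (by linarith)) _)
  by_cases hep : (e : Sym2 (Fin d → ℤ)) ∈ p.edges
  · rw [if_pos ⟨p, hp, hep⟩]
    have hpath := hp.isPath (fun e' => ha.trans_le (update_mem_Icc ht hs' e e').1)
    exact_mod_cast List.nodup_iff_count_le_one.1 hpath.isTrail.edges_nodup _
  · rw [List.count_eq_zero_of_not_mem hep]
    split_ifs <;> simp

end SingleWeight

/-! ### Translations of the lattice -/

/-- The translation by `x` as an automorphism of the lattice. -/
def translation (x : Fin d → ℤ) : lattice d ≃g lattice d where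
  toEquiv := Equiv.addLeft x
  map_rel_iff' := by
    intro u v
    simp [lattice]

/-- The action on edges of the translation by `x`. -/
def edgeTranslation (x : Fin d → ℤ) : Edge d ≃ Edge d := (translation x).mapEdgeSet

lemma pathTime_map_translation (t : Edge d → ℝ) (x : Fin d → ℤ) {u v : Fin d → ℤ}
    (p : (lattice d).Walk u v) :
    pathTime t (p.map (translation x).toHom) = pathTime (t ∘ edgeTranslation x) p := by
  induction p with
  | nil => rfl
  | cons h p ih =>
    rw [SimpleGraph.Walk.map_cons, pathTime_cons, pathTime_cons, ih]
    rfl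

lemma exists_pathTime_comp_edgeTranslation_eq (t : Edge d → ℝ) (x : Fin d → ℤ)
    {u' v' : Fin d → ℤ} (q : (lattice d).Walk u' v') {u v : Fin d → ℤ} (hu : u' = x + u)
    (hv : v' = x + v) :
    ∃ p : (lattice d).Walk u v, pathTime (t ∘ edgeTranslation x) p = pathTime t q := by
  induction q generalizing u with
  | nil =>
    obtain rfl : u = v := add_left_cancel (hu.symm.trans hv)
    exact ⟨.nil, rfl⟩
  | @cons y z w h q ih =>
    subst hu
    obtain ⟨z, rfl⟩ : ∃ z', z = x + z' := ⟨z - x, by simp⟩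
    obtain ⟨p, hp⟩ := ih rfl hv
    exact ⟨.cons ((translation x).map_rel_iff.1 h) p, by rw [pathTime_cons, pathTime_cons, hp]; rfl⟩

lemma passageTime_comp_edgeTranslation (t : Edge d → ℝ) (x u v : Fin d → ℤ) :
    passageTime (t ∘ edgeTranslation x) u v = passageTime t (x + u) (x + v) := by
  unfold passageTime iInf
  congr 1
  ext r
  constructor
  · rintro ⟨p, rfl⟩
    exact ⟨p.map (translation x).toHom, pathTime_map_translation t x p⟩
  · rintro ⟨q, rfl⟩
    exact exists_pathTime_comp_edgeTranslation_eq t x q rfl rfl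

open Classical in
/-- Among the translates of an edge by the points of a finite set `B` of `ℓ¹` diameter at most
`R / b`, a geodesic uses at most `R / a + 1`. -/
lemma IsGeodesic.sum_translates_le {t : Edge d → ℝ} {a b : ℝ} (ha : 0 < a)
    (ht : ∀ e, t e ∈ Set.Icc a b) {u v : Fin d → ℤ} {p : (lattice d).Walk u v}
    (hp : IsGeodesic t p) (e : Edge d) {B : Finset (Fin d → ℤ)} {R : ℝ} (hR : 0 ≤ R)
    (hB : ∀ x ∈ B, ∀ y ∈ B, b * l1 (x - y) ≤ R) :
    ∑ x ∈ B, (if (((edgeTranslation x).symm e : Edge d) : Sym2 (Fin d → ℤ)) ∈ p.edges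
      then (1 : ℝ) else 0) ≤ R / a + 1 := by
  obtain ⟨⟨y, z⟩, he⟩ := e
  have hmem (x : Fin d → ℤ) (h : (((edgeTranslation x).symm ⟨s(y, z), he⟩ : Edge d) :
      Sym2 (Fin d → ℤ)) ∈ p.edges) : y - x ∈ p.support := by
    have : (((edgeTranslation x).symm ⟨s(y, z), he⟩ : Edge d) : Sym2 (Fin d → ℤ)) =
        s(-x + y, -x + z) := rfl
    rw [this] at h
    have := p.fst_mem_support_of_mem_edges h
    rwa [neg_add_eq_sub] at this
  set S : Set (Fin d → ℤ) := (fun x => y - x) '' B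
  have hpath := hp.isPath (fun e' => ha.trans_le (ht e').1)
  have hcount := hp.countP_support_le ha (fun e => (ht e).1) hR (S := S) (by
    rintro _ ⟨x, hx, rfl⟩ _ ⟨x', hx', rfl⟩
    refine (passageTime_le_l1 (fun e => ⟨ha.le.trans (ht e).1, (ht e).2⟩) _ _).trans ?_
    simpa using hB x hx x' hx')
  refine le_trans ?_ hcount
  rw [Finset.sum_boole, Nat.cast_le, List.countP_eq_length_filter,
    ← List.toFinset_card_of_nodup (hpath.support_nodup.filter _)]
  refine Finset.card_le_card_of_injOn (fun x => y - x) (fun x hx => ?_) fun x _ x' _ h => ?_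
  · simp only [Finset.coe_filter, Set.mem_ofPred_eq] at hx
    have hxS : y - x ∈ S := ⟨x, hx.1, rfl⟩
    simpa using And.intro (hmem x hx.2) hxS
  · simpa using h

/-! ### Resampling and translating the environment -/

section Environment

variable (G : Measure ℝ) [IsProbabilityMeasure G]

instance : IsProbabilityMeasure (envMeasure d G) := by
  unfold envMeasure; infer_instance

lemma measurable_update_edge (e : Edge d) :
    Measurable fun p : (Edge d → ℝ) × ℝ => Function.update p.1 e p.2 := by
  refine measurable_pi_iff.2 fun e' => ?_
  by_cases h : e' = e
  · subst h; simpa using measurable_snd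
  · simp only [Function.update_of_ne h]
    exact (measurable_pi_apply e').comp measurable_fst

/-- Replacing the weight of one edge by an independent copy does not change the law of the
environment. -/
lemma measurePreserving_update (e : Edge d) :
    MeasurePreserving (fun p : (Edge d → ℝ) × ℝ => Function.update p.1 e p.2)
      ((envMeasure d G).prod G) (envMeasure d G) := by
  refine ⟨measurable_update_edge e, Measure.eq_infinitePi _ fun s A hA => ?_⟩
  rw [Measure.map_apply (measurable_update_edge e)
    (.pi s.countable_toSet fun i _ => hA i)]
  by_cases he : e ∈ s
  · have : (fun p : (Edge d → ℝ) × ℝ => Function.update p.1 e p.2) ⁻¹' (Set.pi s A) =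
        (Set.pi (s.erase e : Finset (Edge d)) A) ×ˢ (A e) := by
      ext ⟨t, x⟩
      simp only [Set.mem_preimage, Set.mem_pi, Finset.mem_coe, Set.mem_prod, Finset.mem_erase]
      constructor
      · intro h
        exact ⟨fun i hi => by simpa [hi.1] using h i hi.2, by simpa using h e he⟩
      · rintro ⟨h1, h2⟩ i hi
        by_cases hie : i = e
        · subst hie; simpa using h2
        · simpa [hie] using h1 i ⟨hie, hi⟩
    rw [this, Measure.prod_prod, envMeasure, Measure.infinitePi_pi _ (fun i _ => hA i),
      Finset.prod_erase_mul _ _ he]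
  · have : (fun p : (Edge d → ℝ) × ℝ => Function.update p.1 e p.2) ⁻¹' (Set.pi s A) =
        (Set.pi s A) ×ˢ Set.univ := by
      ext ⟨t, x⟩
      simp only [Set.mem_preimage, Set.mem_pi, Finset.mem_coe, Set.mem_prod, Set.mem_univ, and_true]
      refine forall₂_congr fun i hi => ?_
      have : i ≠ e := fun h => he (h ▸ hi)
      simp [this]
    rw [this, Measure.prod_prod, measure_univ, mul_one, envMeasure,
      Measure.infinitePi_pi _ (fun i _ => hA i)]

lemma measurePreserving_comp_equiv (σ : Edge d ≃ Edge d) :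
    MeasurePreserving (fun t : Edge d → ℝ => t ∘ σ) (envMeasure d G) (envMeasure d G) := by
  have hm : Measurable (fun t : Edge d → ℝ => t ∘ σ) :=
    measurable_pi_iff.2 fun i => measurable_pi_apply (σ i)
  refine ⟨hm, Measure.eq_infinitePi _ fun s A hA => ?_⟩
  rw [Measure.map_apply hm (.pi s.countable_toSet fun i _ => hA i)]
  have : (fun t : Edge d → ℝ => t ∘ σ) ⁻¹' (Set.pi s A) =
      Set.pi (s.map σ.toEmbedding : Finset (Edge d)) (fun i => A (σ.symm i)) := by
    ext t
    simp only [Set.mem_preimage, Set.mem_pi, Finset.mem_coe, Finset.mem_map_equiv]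
    exact ⟨fun h i hi => by simpa using h _ hi, fun h i hi => by simpa using h (σ i) (by simpa)⟩
  rw [this, envMeasure, Measure.infinitePi_pi _ (fun i _ => hA _)]
  simp

lemma integral_resample {g : (Edge d → ℝ) → ℝ} (hg : Integrable g (envMeasure d G)) (e : Edge d) :
    Integrable (fun t => ∫ s, g (Function.update t e s) ∂G) (envMeasure d G) ∧
      ∫ t, g t ∂(envMeasure d G) =
        ∫ t, ∫ s, g (Function.update t e s) ∂G ∂(envMeasure d G) := by
  have hmp := measurePreserving_update G e
  have hint : Integrable (fun p : (Edge d → ℝ) × ℝ => g (Function.update p.1 e p.2))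
      ((envMeasure d G).prod G) := hmp.integrable_comp_of_integrable hg
  refine ⟨hint.integral_prod_left, ?_⟩
  rw [← integral_prod _ hint, ← integral_map (f := g) hmp.measurable.aemeasurable
    (by rw [hmp.map_eq]; exact hg.aestronglyMeasurable), hmp.map_eq]

/-- To compare two expectations it is enough to compare the conditional expectations given all
weights but one. -/
lemma integral_le_of_resample_le {g₁ g₂ : (Edge d → ℝ) → ℝ} (h₁ : Integrable g₁ (envMeasure d G))
    (h₂ : Integrable g₂ (envMeasure d G)) (e : Edge d)
    (h : ∀ᵐ t ∂(envMeasure d G), ∫ s, g₁ (Function.update t e s) ∂G ≤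
      ∫ s, g₂ (Function.update t e s) ∂G) :
    ∫ t, g₁ t ∂(envMeasure d G) ≤ ∫ t, g₂ t ∂(envMeasure d G) := by
  rw [(integral_resample G h₁ e).2, (integral_resample G h₂ e).2]
  exact integral_mono_ae (integral_resample G h₁ e).1 (integral_resample G h₂ e).1 h

variable {G}

lemma ae_env {s : Set ℝ} (h : ∀ᵐ x ∂G, x ∈ s) : ∀ᵐ t ∂(envMeasure d G), ∀ e, t e ∈ s :=
  ae_all_iff.2 fun e =>
    (measurePreserving_eval_infinitePi (fun _ : Edge d => G) e).quasiMeasurePreserving.ae h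

end Environment

/-! ### Covariance with the identity on the line -/

section Covariance

lemma ae_prod_mem_Icc {G : Measure ℝ} [SFinite G] {a b : ℝ} (hG : ∀ᵐ x ∂G, x ∈ Set.Icc a b) :
    ∀ᵐ p : ℝ × ℝ ∂(G.prod G), p.1 ∈ Set.Icc a b ∧ p.2 ∈ Set.Icc a b :=
  (Measure.quasiMeasurePreserving_fst.ae hG).and (Measure.quasiMeasurePreserving_snd.ae hG)

variable {G : Measure ℝ} [IsProbabilityMeasure G] {a b K : ℝ} {F : ℝ → ℝ}

lemma integrable_of_abs_le {Ω : Type*} [MeasurableSpace Ω] {P : Measure Ω} [IsProbabilityMeasure P]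
    {f : Ω → ℝ} (hf : Measurable f) {C : ℝ} (h : ∀ᵐ x ∂P, |f x| ≤ C) : Integrable f P :=
  Integrable.of_bound hf.aestronglyMeasurable C h

/-- The covariance of `F(X)` and `X`, as an integral over two independent copies of `X`. -/
lemma integral_prod_sub_mul_sub (hG : ∀ᵐ x ∂G, x ∈ Set.Icc a b) (hF : Measurable F)
    (hK : ∀ s ∈ Set.Icc a b, |F s| ≤ K) :
    Integrable (fun p : ℝ × ℝ => (F p.1 - F p.2) * (p.1 - p.2)) (G.prod G) ∧
      ∫ p : ℝ × ℝ, (F p.1 - F p.2) * (p.1 - p.2) ∂(G.prod G) =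
        2 * ∫ s, F s * (s - ∫ x, x ∂G) ∂G := by
  have hid : Integrable (fun x : ℝ => x) G := integrable_of_abs_le measurable_id
    (hG.mono fun x hx => show |x| ≤ max |a| |b| from abs_le_max_abs_abs hx.1 hx.2)
  have hFi : Integrable F G := integrable_of_abs_le hF (hG.mono hK)
  have hFid : Integrable (fun x => F x * x) G := integrable_of_abs_le (hF.mul measurable_id)
    (hG.mono fun x hx => show |F x * x| ≤ K * max |a| |b| by
      rw [abs_mul]
      exact mul_le_mul (hK x hx) (abs_le_max_abs_abs hx.1 hx.2) (abs_nonneg _)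
        ((abs_nonneg _).trans (hK x hx)))
  have i1 : Integrable (fun p : ℝ × ℝ => F p.1 * p.1) (G.prod G) := hFid.comp_fst G
  have i2 : Integrable (fun p : ℝ × ℝ => F p.2 * p.2) (G.prod G) := hFid.comp_snd G
  have i3 : Integrable (fun p : ℝ × ℝ => F p.1 * p.2) (G.prod G) := hFi.mul_prod hid
  have i4 : Integrable (fun p : ℝ × ℝ => p.1 * F p.2) (G.prod G) := hid.mul_prod hFi
  have heq : (fun p : ℝ × ℝ => (F p.1 - F p.2) * (p.1 - p.2)) =
      fun p => (F p.1 * p.1 + F p.2 * p.2) - (F p.1 * p.2 + p.1 * F p.2) := by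
    ext p; ring
  have hR : ∫ s, F s * (s - ∫ x, x ∂G) ∂G = ∫ s, F s * s ∂G - (∫ s, F s ∂G) * ∫ x, x ∂G := by
    simp_rw [mul_sub]
    rw [integral_sub hFid (hFi.mul_const _), integral_mul_const]
  rw [heq]
  refine ⟨(i1.add i2).sub (i3.add i4), ?_⟩
  have e1 : ∫ p : ℝ × ℝ, F p.1 * p.1 ∂(G.prod G) = ∫ s, F s * s ∂G := by
    simpa using integral_fun_fst (μ := G) (ν := G) (fun s => F s * s)
  have e2 : ∫ p : ℝ × ℝ, F p.2 * p.2 ∂(G.prod G) = ∫ s, F s * s ∂G := by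
    simpa using integral_fun_snd (μ := G) (ν := G) (fun s => F s * s)
  have e3 := integral_prod_mul (μ := G) (ν := G) F (fun x : ℝ => x)
  have e4 := integral_prod_mul (μ := G) (ν := G) (fun x : ℝ => x) F
  have e12 := integral_add i1 i2
  have e34 := integral_add i3 i4
  have e := integral_sub (i1.add i2) (i3.add i4)
  simp only [Pi.add_apply] at e
  rw [e, e12, e34, e1, e2, e3, e4, hR]
  ring

/-- If `F` is nondecreasing, and has slope one to the left of each point of `E`, then the
covariance of `F(X)` and `X` is bounded below in terms of `P(X ∈ E)`. -/
lemma le_integral_mul_sub_mean (hG : ∀ᵐ x ∂G, x ∈ Set.Icc a b) (hF : Measurable F)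
    (hK : ∀ s ∈ Set.Icc a b, |F s| ≤ K)
    (hmono : ∀ s ∈ Set.Icc a b, ∀ s' ∈ Set.Icc a b, s' ≤ s → F s' ≤ F s)
    {E : Set ℝ} (hE : MeasurableSet E)
    (hslope : ∀ s ∈ Set.Icc a b, ∀ s' ∈ Set.Icc a b, s ∈ E → s' ≤ s → F s' + (s - s') ≤ F s)
    {q₁ q₂ : ℝ} (hq : q₁ ≤ q₂) :
    (q₂ - q₁) ^ 2 * G.real (Set.Iic q₁) / 2 * G.real (E ∩ Set.Ici q₂) ≤
      ∫ s, F s * (s - ∫ x, x ∂G) ∂G := by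
  obtain ⟨hint, heq⟩ := integral_prod_sub_mul_sub hG hF hK
  have hA : MeasurableSet ((E ∩ Set.Ici q₂) ×ˢ Set.Iic q₁) :=
    (hE.inter measurableSet_Ici).prod measurableSet_Iic
  have key : ∫ p, ((E ∩ Set.Ici q₂) ×ˢ Set.Iic q₁).indicator (fun _ => (q₂ - q₁) ^ 2) p
      ∂(G.prod G) ≤ ∫ p : ℝ × ℝ, (F p.1 - F p.2) * (p.1 - p.2) ∂(G.prod G) := by
    refine integral_mono_ae ((integrable_const _).indicator hA) hint ?_
    filter_upwards [ae_prod_mem_Icc hG] with p hp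
    by_cases hpA : p ∈ (E ∩ Set.Ici q₂) ×ˢ Set.Iic q₁
    · rw [Set.indicator_of_mem hpA]
      obtain ⟨⟨h1, h2⟩, h3⟩ := hpA
      have h2 : q₂ ≤ p.1 := h2
      have h3 : p.2 ≤ q₁ := h3
      have := hslope p.1 hp.1 p.2 hp.2 h1 (by linarith)
      nlinarith
    · rw [Set.indicator_of_notMem hpA]
      rcases le_total p.2 p.1 with h | h
      · exact mul_nonneg (sub_nonneg.2 (hmono _ hp.1 _ hp.2 h)) (sub_nonneg.2 h)
      · exact mul_nonneg_of_nonpos_of_nonpos (sub_nonpos.2 (hmono _ hp.2 _ hp.1 h))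
          (sub_nonpos.2 h)
  rw [integral_indicator_const _ hA, measureReal_prod_prod, heq, smul_eq_mul] at key
  linarith

/-- If `F` is nondecreasing, has slope at most one, and is constant to the right of each point
outside `E`, then the covariance of `F(X)` and `X` is bounded above in terms of `P(X ∈ E)`. -/
lemma integral_mul_sub_mean_le (hG : ∀ᵐ x ∂G, x ∈ Set.Icc a b) (hF : Measurable F)
    (hK : ∀ s ∈ Set.Icc a b, |F s| ≤ K) {E : Set ℝ} (hE : MeasurableSet E)
    (hslope : ∀ s ∈ Set.Icc a b, ∀ s' ∈ Set.Icc a b, s' ≤ s →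
      F s ≤ F s' + (s - s') * E.indicator 1 s') :
    ∫ s, F s * (s - ∫ x, x ∂G) ∂G ≤ (b - a) ^ 2 * G.real E := by
  obtain ⟨hint, heq⟩ := integral_prod_sub_mul_sub hG hF hK
  have hi : Integrable (E.indicator (1 : ℝ → ℝ)) G := (integrable_const (1 : ℝ)).indicator hE
  have key : ∫ p : ℝ × ℝ, (F p.1 - F p.2) * (p.1 - p.2) ∂(G.prod G) ≤
      ∫ p : ℝ × ℝ, (b - a) ^ 2 * (E.indicator (1 : ℝ → ℝ) p.1 + E.indicator (1 : ℝ → ℝ) p.2)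
        ∂(G.prod G) := by
    refine integral_mono_ae hint (((hi.comp_fst G).add (hi.comp_snd G)).const_mul _) ?_
    filter_upwards [ae_prod_mem_Icc hG] with p hp
    obtain ⟨⟨h1, h2⟩, h3, h4⟩ := hp
    have hn (s : ℝ) : (0 : ℝ) ≤ E.indicator 1 s := Set.indicator_nonneg (fun _ _ => zero_le_one) s
    have aux (s s' : ℝ) (hs : s ∈ Set.Icc a b) (hs' : s' ∈ Set.Icc a b) (hss : s' ≤ s) :
        (F s - F s') * (s - s') ≤
          (b - a) ^ 2 * (E.indicator (1 : ℝ → ℝ) s + E.indicator (1 : ℝ → ℝ) s') := by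
      have h0 := hslope s hs s' hs' hss
      calc (F s - F s') * (s - s') ≤ ((s - s') * E.indicator 1 s') * (s - s') :=
            mul_le_mul_of_nonneg_right (by linarith) (by linarith)
        _ = (s - s') ^ 2 * E.indicator 1 s' := by ring
        _ ≤ (b - a) ^ 2 * E.indicator 1 s' :=
            mul_le_mul_of_nonneg_right
              (pow_le_pow_left₀ (by linarith) (by linarith [hs.2, hs'.1]) 2) (hn s')
        _ ≤ _ := mul_le_mul_of_nonneg_left (by linarith [hn s]) (sq_nonneg _)
    rcases le_total p.2 p.1 with h | h
    · exact aux _ _ ⟨h1, h2⟩ ⟨h3, h4⟩ h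
    · have := aux _ _ ⟨h3, h4⟩ ⟨h1, h2⟩ h
      calc _ = (F p.2 - F p.1) * (p.2 - p.1) := by ring
        _ ≤ _ := this
        _ = _ := by ring
  have e1 : ∫ p : ℝ × ℝ, E.indicator (1 : ℝ → ℝ) p.1 ∂(G.prod G) = G.real E := by
    have := integral_fun_fst (μ := G) (ν := G) (E.indicator (1 : ℝ → ℝ))
    rw [this, integral_indicator_one hE]
    simp
  have e2 : ∫ p : ℝ × ℝ, E.indicator (1 : ℝ → ℝ) p.2 ∂(G.prod G) = G.real E := by
    have := integral_fun_snd (μ := G) (ν := G) (E.indicator (1 : ℝ → ℝ))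
    rw [this, integral_indicator_one hE]
    simp
  rw [heq, integral_const_mul, integral_add (hi.comp_fst G) (hi.comp_snd G), e1, e2] at key
  linarith

end Covariance

/-! ### Almost sure uniqueness of geodesics -/

/-- Two distinct paths with the same endpoints differ in an edge, whose weight has no atoms. -/
lemma ae_pathTime_ne (G : Measure ℝ) [IsProbabilityMeasure G] [NullSingletonClass G]
    {u v : Fin d → ℤ} {p q : (lattice d).Walk u v} (hp : p.IsPath) (hq : q.IsPath) (hpq : p ≠ q) :
    ∀ᵐ t ∂(envMeasure d G), pathTime t p ≠ pathTime t q := by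
  obtain ⟨e, hep, heq⟩ : ∃ e ∈ p.edges, e ∉ q.edges := by
    by_contra! h
    exact hpq (eq_of_edges_subset hp hq h)
  let e' : Edge d := ⟨e, p.edges_subset_edgeSet hep⟩
  have hmeas : MeasurableSet {t : Edge d → ℝ | pathTime t p = pathTime t q} :=
    measurableSet_eq_fun (measurable_pathTime p) (measurable_pathTime q)
  have hmp := measurePreserving_update (d := d) G e'
  have : envMeasure d G {t : Edge d → ℝ | pathTime t p = pathTime t q} = 0 := by
    rw [← hmp.measure_preimage hmeas.nullMeasurableSet,
      Measure.measure_prod_null (hmp.measurable hmeas)]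
    refine Filter.Eventually.of_forall fun t => Set.Subsingleton.measure_zero ?_ _
    -- Given the other weights, the equality of the two passage times determines the weight of `e`.
    intro s hs s' hs'
    have h1 : pathTime (Function.update t e' s) p = pathTime (Function.update t e' s) q := hs
    have h2 : pathTime (Function.update t e' s') p = pathTime (Function.update t e' s') q := hs'
    have hc : q.edges.count (e' : Sym2 (Fin d → ℤ)) = 0 := List.count_eq_zero_of_not_mem heq
    have hc' : 1 ≤ p.edges.count (e' : Sym2 (Fin d → ℤ)) := List.count_pos_iff.2 hep
    rw [pathTime_update_sub t e' s s' p, pathTime_update_sub t e' s s' q, h2, hc] at h1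
    have : (p.edges.count (e' : Sym2 (Fin d → ℤ)) : ℝ) ≠ 0 := by
      have : 0 < p.edges.count (e' : Sym2 (Fin d → ℤ)) := hc'
      positivity
    have h3 : (s - s') * (p.edges.count (e' : Sym2 (Fin d → ℤ)) : ℝ) = 0 := by
      push_cast at h1
      linarith
    exact sub_eq_zero.1 ((mul_eq_zero.1 h3).resolve_right this)
  exact measure_eq_zero_iff_ae_notMem.1 this

lemma measurable_sub_mean (G : Measure ℝ) (e : Edge d) :
    Measurable fun t : Edge d → ℝ => t e - ∫ x, x ∂G :=
  (measurable_pi_apply e).sub_const _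

section Weights

variable {G : Measure ℝ} [IsProbabilityMeasure G] {a b : ℝ}

lemma ae_existsUnique_isGeodesic [NullSingletonClass G] (ha : 0 < a) (hG : ∀ᵐ x ∂G, x ∈ Set.Icc a b) :
    ∀ᵐ t ∂(envMeasure d G), ∀ u v : Fin d → ℤ, ∃! p : (lattice d).Walk u v, IsGeodesic t p := by
  have h : ∀ᵐ t ∂(envMeasure d G), ∀ (u v : Fin d → ℤ) (p q : (lattice d).Walk u v),
      p.IsPath → q.IsPath → p ≠ q → pathTime t p ≠ pathTime t q := by
    simp only [ae_all_iff]
    exact fun u v p q hp hq hpq => ae_pathTime_ne G hp hq hpq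
  filter_upwards [h, ae_env hG] with t ht htG u v
  obtain ⟨p, hp⟩ := exists_isGeodesic ha (fun e => (htG e).1) u v
  have hpos : ∀ e, 0 < t e := fun e => ha.trans_le (htG e).1
  refine ⟨p, hp, fun q hq => ?_⟩
  by_contra hqp
  exact ht u v q p (hq.isPath hpos) (hp.isPath hpos) hqp (le_antisymm (hq p) (hp q))

/-! ### The covariance of the passage time and a weight -/

lemma mean_mem_Icc (hG : ∀ᵐ x ∂G, x ∈ Set.Icc a b) : ∫ x, x ∂G ∈ Set.Icc a b := by
  have hid : Integrable (fun x : ℝ => x) G := integrable_of_abs_le measurable_id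
    (hG.mono fun x hx => show |x| ≤ max |a| |b| from abs_le_max_abs_abs hx.1 hx.2)
  constructor
  · simpa using integral_mono_ae (integrable_const a) hid (hG.mono fun x hx => hx.1)
  · simpa using integral_mono_ae hid (integrable_const b) (hG.mono fun x hx => hx.2)

lemma ae_abs_sub_mean_le (hG : ∀ᵐ x ∂G, x ∈ Set.Icc a b) :
    ∀ᵐ t ∂(envMeasure d G), ∀ e, |t e - ∫ x, x ∂G| ≤ b - a := by
  filter_upwards [ae_env hG] with t ht e
  have h1 := ht e
  have h2 := mean_mem_Icc hG
  rw [abs_le]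
  constructor <;> linarith [h1.1, h1.2, h2.1, h2.2]

lemma integrable_mul_sub_mean (hG : ∀ᵐ x ∂G, x ∈ Set.Icc a b) {D : (Edge d → ℝ) → ℝ}
    (hD : Measurable D) {K : ℝ} (hK : ∀ᵐ t ∂(envMeasure d G), |D t| ≤ K) (e : Edge d) :
    Integrable (fun t => D t * (t e - ∫ x, x ∂G)) (envMeasure d G) := by
  refine integrable_of_abs_le (hD.mul (measurable_sub_mean G e)) (C := K * (b - a)) ?_
  filter_upwards [hK, ae_abs_sub_mean_le hG] with t h1 h2
  rw [abs_mul]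
  exact mul_le_mul h1 (h2 e) (abs_nonneg _) ((abs_nonneg _).trans h1)

lemma integral_sub_mean_mul_sub_mean (hG : ∀ᵐ x ∂G, x ∈ Set.Icc a b) {e e' : Edge d}
    (h : e ≠ e') :
    ∫ t, (t e - ∫ x, x ∂G) * (t e' - ∫ x, x ∂G) ∂(envMeasure d G) = 0 := by
  have hid : Integrable (fun x : ℝ => x) G := integrable_of_abs_le measurable_id
    (hG.mono fun x hx => show |x| ≤ max |a| |b| from abs_le_max_abs_abs hx.1 hx.2)
  rw [(integral_resample G (integrable_mul_sub_mean hG (measurable_sub_mean G e)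
    ((ae_abs_sub_mean_le hG).mono fun t ht => ht e) e') e).2]
  have : ∀ t : Edge d → ℝ, ∫ s, (Function.update t e s e - ∫ x, x ∂G) *
      (Function.update t e s e' - ∫ x, x ∂G) ∂G = 0 := by
    intro t
    simp only [Function.update_self, Function.update_of_ne h.symm]
    rw [integral_mul_const, integral_sub hid (integrable_const _)]
    simp
  simp only [this, integral_zero]

/-- Bessel's inequality for the covariances of a bounded function of the environment and the
centred weights, which are orthogonal in `L²`. -/
lemma sum_sq_integral_mul_sub_mean_le (hab : a < b) (hG : ∀ᵐ x ∂G, x ∈ Set.Icc a b)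
    {D : (Edge d → ℝ) → ℝ} (hD : Measurable D) {K : ℝ}
    (hK : ∀ᵐ t ∂(envMeasure d G), |D t| ≤ K) (S : Finset (Edge d)) :
    ∑ e ∈ S, (∫ t, D t * (t e - ∫ x, x ∂G) ∂(envMeasure d G)) ^ 2 ≤ (b - a) ^ 2 * K ^ 2 := by
  set μ := ∫ x, x ∂G with hμ
  set P := envMeasure d G with hP
  set c : Edge d → ℝ := fun e => ∫ t, D t * (t e - μ) ∂P with hc
  set M : ℝ := (b - a) ^ 2 with hM
  have hMpos : 0 < M := pow_pos (sub_pos.2 hab) 2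
  have hW (e : Edge d) : ∀ᵐ t ∂P, |t e - μ| ≤ b - a := (ae_abs_sub_mean_le hG).mono fun t ht => ht e
  have iDW (e : Edge d) : Integrable (fun t => D t * (t e - μ)) P :=
    integrable_mul_sub_mean hG hD hK e
  have iWW (e e' : Edge d) : Integrable (fun t => (t e - μ) * (t e' - μ)) P :=
    integrable_mul_sub_mean hG (measurable_sub_mean G e) (hW e) e'
  have iDD : Integrable (fun t => D t ^ 2) P := integrable_of_abs_le (hD.pow_const 2) (C := K ^ 2)
    (hK.mono fun t ht => by rw [abs_pow]; exact pow_le_pow_left₀ (abs_nonneg _) ht 2)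
  have eD : ∫ t, D t ^ 2 ∂P ≤ K ^ 2 := by
    have := integral_mono_ae iDD (integrable_const (K ^ 2))
      (hK.mono fun t ht => show D t ^ 2 ≤ K ^ 2 from sq_le_sq' (abs_le.1 ht).1 (abs_le.1 ht).2)
    simpa using this
  have eWW (e e' : Edge d) : c e * c e' * ∫ t, (t e - μ) * (t e' - μ) ∂P ≤
      if e = e' then M * c e ^ 2 else 0 := by
    split_ifs with h
    · subst h
      have := integral_mono_ae (iWW e e) (integrable_const M) ((hW e).mono fun t ht =>
        show (t e - μ) * (t e - μ) ≤ M by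
          rw [← sq]; exact sq_le_sq' (abs_le.1 ht).1 (abs_le.1 ht).2)
      simp only [integral_const, probReal_univ, one_smul] at this
      nlinarith [sq_nonneg (c e)]
    · rw [integral_sub_mean_mul_sub_mean hG h, mul_zero]
  have hY : ∀ t : Edge d → ℝ, (M * D t - ∑ e ∈ S, c e * (t e - μ)) ^ 2 =
      M ^ 2 * D t ^ 2 - 2 * M * ∑ e ∈ S, c e * (D t * (t e - μ)) +
        ∑ e ∈ S, ∑ e' ∈ S, c e * c e' * ((t e - μ) * (t e' - μ)) := by
    intro t
    have h1 : ∑ e ∈ S, ∑ e' ∈ S, c e * c e' * ((t e - μ) * (t e' - μ)) =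
        (∑ e ∈ S, c e * (t e - μ)) ^ 2 := by
      rw [sq, Finset.sum_mul_sum]
      exact Finset.sum_congr rfl fun e _ => Finset.sum_congr rfl fun e' _ => by ring
    have h2 : ∑ e ∈ S, c e * (D t * (t e - μ)) = D t * ∑ e ∈ S, c e * (t e - μ) := by
      rw [Finset.mul_sum]
      exact Finset.sum_congr rfl fun e _ => by ring
    rw [h1, h2]
    ring
  have i1 : Integrable (fun t => M ^ 2 * D t ^ 2) P := iDD.const_mul _
  have i2 : Integrable (fun t => 2 * M * ∑ e ∈ S, c e * (D t * (t e - μ))) P :=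
    (integrable_finsetSum S fun e _ => (iDW e).const_mul _).const_mul _
  have i3 : Integrable (fun t => ∑ e ∈ S, ∑ e' ∈ S, c e * c e' * ((t e - μ) * (t e' - μ))) P :=
    integrable_finsetSum S fun e _ => integrable_finsetSum S fun e' _ => (iWW e e').const_mul _
  have h0 : 0 ≤ ∫ t, (M * D t - ∑ e ∈ S, c e * (t e - μ)) ^ 2 ∂P :=
    integral_nonneg fun t => sq_nonneg _
  simp_rw [hY] at h0
  have e12 := integral_sub i1 i2
  have e123 := integral_add (i1.sub i2) i3
  simp only [Pi.sub_apply] at e123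
  rw [e123, e12, integral_const_mul, integral_const_mul,
    integral_finsetSum S fun e _ => (iDW e).const_mul _,
    integral_finsetSum S fun e _ => integrable_finsetSum S fun e' _ => (iWW e e').const_mul _] at h0
  have h2 : ∑ e ∈ S, ∫ t, c e * (D t * (t e - μ)) ∂P = ∑ e ∈ S, c e ^ 2 :=
    Finset.sum_congr rfl fun e _ => by rw [integral_const_mul, sq]
  have h3 : ∑ e ∈ S, ∫ t, ∑ e' ∈ S, c e * c e' * ((t e - μ) * (t e' - μ)) ∂P ≤
      M * ∑ e ∈ S, c e ^ 2 := by
    rw [Finset.mul_sum]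
    refine Finset.sum_le_sum fun e he => ?_
    rw [integral_finsetSum S fun e' _ => (iWW e e').const_mul _]
    simp_rw [integral_const_mul]
    calc _ ≤ ∑ e' ∈ S, if e = e' then M * c e ^ 2 else 0 := Finset.sum_le_sum fun e' _ => eWW e e'
      _ = M * c e ^ 2 := by simp [he]
  rw [h2] at h0
  have h4 : M * ∑ e ∈ S, c e ^ 2 ≤ M * (M * K ^ 2) := by nlinarith
  exact le_of_mul_le_mul_left h4 hMpos

/-- The covariance of the passage time `T(0, v)` and the weight of the edge `e`. -/
noncomputable def edgeCov (G : Measure ℝ) [IsProbabilityMeasure G] (v : Fin d → ℤ) (e : Edge d) :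
    ℝ :=
  ∫ t, passageTime t 0 v * (t e - ∫ x, x ∂G) ∂(envMeasure d G)

lemma abs_passageTime_le {t : Edge d → ℝ} (ha : 0 < a) (ht : ∀ e, t e ∈ Set.Icc a b)
    (u v : Fin d → ℤ) : |passageTime t u v| ≤ b * l1 (v - u) := by
  rw [abs_of_nonneg (passageTime_nonneg (fun e => ha.le.trans (ht e).1) u v)]
  exact passageTime_le_l1 (fun e => ⟨ha.le.trans (ht e).1, (ht e).2⟩) u v

lemma integrable_passageTime_mul (ha : 0 < a) (hG : ∀ᵐ x ∂G, x ∈ Set.Icc a b)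
    (u v : Fin d → ℤ) (e : Edge d) :
    Integrable (fun t => passageTime t u v * (t e - ∫ x, x ∂G)) (envMeasure d G) :=
  integrable_mul_sub_mean hG (measurable_passageTime u v)
    ((ae_env hG).mono fun _ ht => abs_passageTime_le ha ht u v) e

lemma measurable_update_right (t : Edge d → ℝ) (e : Edge d) :
    Measurable fun s : ℝ => Function.update t e s :=
  (measurable_update_edge e).comp measurable_prodMk_left

/-- An edge that is likely to lie on the geodesic has a large covariance. When the edge is on the
geodesic, the passage time decreases with slope one as its weight is lowered; the term
`G (Iio q₂)` discards the event that there is no room to lower it from above `q₂` to below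
`q₁`. -/
lemma le_edgeCov (ha : 0 < a) (hG : ∀ᵐ x ∂G, x ∈ Set.Icc a b) {q₁ q₂ : ℝ} (hq : q₁ ≤ q₂)
    (v : Fin d → ℤ) (e : Edge d) :
    (q₂ - q₁) ^ 2 * G.real (Set.Iic q₁) / 2 *
        ((envMeasure d G).real {t | e ∈ geodesicEdges t 0 v} - G.real (Set.Iio q₂)) ≤
      edgeCov G v e := by
  set c := (q₂ - q₁) ^ 2 * G.real (Set.Iic q₁) / 2 with hc
  have hc0 : 0 ≤ c := by positivity
  set A : Set (Edge d → ℝ) := {t | e ∈ geodesicEdges t 0 v} ∩ {t | t e ∈ Set.Ici q₂} with hA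
  have hAm : MeasurableSet A :=
    (measurableSet_mem_geodesicEdges e 0 v).inter (measurable_pi_apply e measurableSet_Ici)
  have h1 : (envMeasure d G).real {t | e ∈ geodesicEdges t 0 v} - G.real (Set.Iio q₂) ≤
      (envMeasure d G).real A := by
    have hmp := measurePreserving_eval_infinitePi (fun _ : Edge d => G) e
    have hG2 : G.real (Set.Iio q₂) = (envMeasure d G).real {t : Edge d → ℝ | t e ∈ Set.Iio q₂} :=
      (hmp.measureReal_preimage measurableSet_Iio.nullMeasurableSet).symm
    rw [hG2, sub_le_iff_le_add]
    refine (measureReal_mono ?_).trans (measureReal_union_le _ _)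
    intro t ht
    rcases lt_or_ge (t e) q₂ with h | h
    · exact Or.inr h
    · exact Or.inl ⟨ht, h⟩
  calc _ ≤ c * (envMeasure d G).real A := mul_le_mul_of_nonneg_left h1 hc0
    _ = ∫ t, A.indicator (fun _ => c) t ∂(envMeasure d G) := by
        rw [integral_indicator_const _ hAm, smul_eq_mul, mul_comm]
    _ ≤ edgeCov G v e := by
        refine integral_le_of_resample_le G ((integrable_const _).indicator hAm)
          (integrable_passageTime_mul ha hG 0 v e) e ?_
        filter_upwards [ae_env hG] with t ht
        have hEm : MeasurableSet {s | e ∈ geodesicEdges (Function.update t e s) 0 v} :=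
          measurable_update_right t e (measurableSet_mem_geodesicEdges e 0 v)
        have := le_integral_mul_sub_mean (G := G) hG
          (F := fun s => passageTime (Function.update t e s) 0 v)
          ((measurable_passageTime 0 v).comp (measurable_update_right t e))
          (fun s hs => abs_passageTime_le ha (update_mem_Icc ht hs e) 0 v)
          (fun s hs s' hs' hss => passageTime_update_mono ha ht hs hs' hss)
          hEm (fun s hs s' hs' hsE hss => passageTime_update_add_sub_le ha ht hs' hss hsE) hq
        simp only [Function.update_self]
        refine le_trans (le_of_eq ?_) this
        rw [← hc, mul_comm c, ← smul_eq_mul,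
          ← integral_indicator_const c (hEm.inter measurableSet_Ici)]
        congr 1
        ext s
        classical
        rw [Set.indicator_apply, Set.indicator_apply]
        refine if_congr ?_ rfl rfl
        change e ∈ geodesicEdges (Function.update t e s) 0 v ∧ Function.update t e s e ∈ Set.Ici q₂
          ↔ e ∈ geodesicEdges (Function.update t e s) 0 v ∧ s ∈ Set.Ici q₂
        rw [Function.update_self]

/-- An edge that is unlikely to lie on the geodesic has a small covariance. -/
lemma edgeCov_le (ha : 0 < a) (hG : ∀ᵐ x ∂G, x ∈ Set.Icc a b) (v : Fin d → ℤ) (e : Edge d) :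
    edgeCov G v e ≤ (b - a) ^ 2 * (envMeasure d G).real {t | e ∈ geodesicEdges t 0 v} := by
  set A : Set (Edge d → ℝ) := {t | e ∈ geodesicEdges t 0 v} with hA
  have hAm : MeasurableSet A := measurableSet_mem_geodesicEdges e 0 v
  calc edgeCov G v e ≤ ∫ t, A.indicator (fun _ => (b - a) ^ 2) t ∂(envMeasure d G) := by
        refine integral_le_of_resample_le G (integrable_passageTime_mul ha hG 0 v e)
          ((integrable_const _).indicator hAm) e ?_
        filter_upwards [ae_env hG] with t ht
        have hEm : MeasurableSet {s | e ∈ geodesicEdges (Function.update t e s) 0 v} :=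
          measurable_update_right t e hAm
        have := integral_mul_sub_mean_le (G := G) hG
          (F := fun s => passageTime (Function.update t e s) 0 v)
          ((measurable_passageTime 0 v).comp (measurable_update_right t e))
          (fun s hs => abs_passageTime_le ha (update_mem_Icc ht hs e) 0 v) hEm
          (fun s hs s' hs' hss => by
            refine (passageTime_update_le_add (e := e) ha ht hs hs' hss).trans (le_of_eq ?_)
            simp [Set.indicator])
        simp only [Function.update_self]
        refine this.trans (le_of_eq ?_)
        rw [mul_comm, ← smul_eq_mul, ← integral_indicator_const _ hEm]
        congr 1
    _ = _ := by rw [integral_indicator_const _ hAm, smul_eq_mul, mul_comm]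

/-- By translation invariance, the covariances for `T(x, x + v)` are translates of those for
`T(0, v)`. -/
lemma integral_passageTime_translate_mul (v x : Fin d → ℤ) (e : Edge d) :
    ∫ t, passageTime t x (x + v) * (t e - ∫ x, x ∂G) ∂(envMeasure d G) =
      edgeCov G v ((edgeTranslation x).symm e) := by
  have hmp := measurePreserving_comp_equiv (d := d) G (edgeTranslation x)
  have hm : Measurable fun t : Edge d → ℝ =>
      passageTime t 0 v * (t ((edgeTranslation x).symm e) - ∫ x, x ∂G) :=
    (measurable_passageTime 0 v).mul (measurable_sub_mean G _)
  rw [edgeCov]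
  conv_rhs => rw [← hmp.map_eq]
  rw [integral_map hmp.measurable.aemeasurable hm.aestronglyMeasurable]
  simp [passageTime_comp_edgeTranslation]

open Classical in
/-- The covariances decay on average: their sum over the translates of an edge by the points of a
finite set is at most of the order of the diameter of that set. -/
lemma sum_edgeCov_translates_le [NullSingletonClass G] (ha : 0 < a) (hG : ∀ᵐ x ∂G, x ∈ Set.Icc a b)
    (v : Fin d → ℤ) (e : Edge d) {B : Finset (Fin d → ℤ)} {R : ℝ} (hR : 0 ≤ R)
    (hB : ∀ x ∈ B, ∀ y ∈ B, b * l1 (x - y) ≤ R) :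
    ∑ x ∈ B, edgeCov G v ((edgeTranslation x).symm e) ≤ (b - a) ^ 2 * (R / a + 1) := by
  set A : (Fin d → ℤ) → Set (Edge d → ℝ) :=
    fun x => {t | (edgeTranslation x).symm e ∈ geodesicEdges t 0 v} with hA
  have hAm (x : Fin d → ℤ) : MeasurableSet (A x) := measurableSet_mem_geodesicEdges _ 0 v
  have hi (x : Fin d → ℤ) : Integrable ((A x).indicator (fun _ => (1 : ℝ))) (envMeasure d G) :=
    (integrable_const _).indicator (hAm x)
  calc _ ≤ ∑ x ∈ B, (b - a) ^ 2 * (envMeasure d G).real (A x) :=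
        Finset.sum_le_sum fun x _ => edgeCov_le ha hG v _
    _ = (b - a) ^ 2 * ∫ t, ∑ x ∈ B, (A x).indicator (fun _ => (1 : ℝ)) t ∂(envMeasure d G) := by
        rw [← Finset.mul_sum, integral_finsetSum B fun x _ => hi x]
        congr 1
        refine Finset.sum_congr rfl fun x _ => ?_
        rw [integral_indicator_const _ (hAm x), smul_eq_mul, mul_one]
    _ ≤ (b - a) ^ 2 * (R / a + 1) := by
        refine mul_le_mul_of_nonneg_left ?_ (sq_nonneg _)
        have : ∫ t, ∑ x ∈ B, (A x).indicator (fun _ => (1 : ℝ)) t ∂(envMeasure d G) ≤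
            ∫ _t, (R / a + 1) ∂(envMeasure d G) := by
          refine integral_mono_ae (integrable_finsetSum B fun x _ => hi x) (integrable_const _) ?_
          filter_upwards [ae_env hG, ae_existsUnique_isGeodesic ha hG] with t ht huniq
          obtain ⟨p, hp, hpu⟩ := huniq 0 v
          refine le_trans (Finset.sum_le_sum fun x _ => ?_) (hp.sum_translates_le ha ht e hR hB)
          by_cases hx : t ∈ A x
          · obtain ⟨q, hq, hxq⟩ := hx
            obtain rfl := hpu q hq
            rw [if_pos hxq]
            exact Set.indicator_le_self' (fun _ _ => zero_le_one) t
          · rw [Set.indicator_of_notMem hx]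
            split_ifs <;> simp
        simpa using this

end Weights

/-! ### Counting the influential edges -/

section Counting

variable {G : Measure ℝ} [IsProbabilityMeasure G] {a b : ℝ}

lemma l1_sub_le_of_mem_box {r : ℕ} {x y : Fin d → ℤ}
    (hx : x ∈ Fintype.piFinset fun _ : Fin d => Finset.Ico (0 : ℤ) r)
    (hy : y ∈ Fintype.piFinset fun _ : Fin d => Finset.Ico (0 : ℤ) r) :
    (l1 (x - y) : ℝ) ≤ d * r := by
  have : l1 (x - y) ≤ d * r := by
    unfold l1
    calc ∑ i, |(x - y) i| ≤ ∑ _i : Fin d, (r : ℤ) := by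
          refine Finset.sum_le_sum fun i _ => ?_
          have h1 := Finset.mem_Ico.1 (Fintype.mem_piFinset.1 hx i)
          have h2 := Finset.mem_Ico.1 (Fintype.mem_piFinset.1 hy i)
          rw [Pi.sub_apply, abs_le]
          constructor <;> omega
      _ = d * r := by simp
  exact_mod_cast this

/-- The number of edges whose weight has covariance at least `κ` with the passage time `T(0, v)`
is bounded uniformly in `v`. -/
lemma exists_card_le_of_le_edgeCov [NullSingletonClass G] (hd : 2 ≤ d) (ha : 0 < a) (hab : a < b)
    (hG : ∀ᵐ x ∂G, x ∈ Set.Icc a b) {κ : ℝ} (hκ : 0 < κ) :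
    ∃ N : ℕ, ∀ (v : Fin d → ℤ) (S : Finset (Edge d)), (∀ e ∈ S, κ ≤ edgeCov G v e) →
      S.card ≤ N := by
  have hb : 0 < b := ha.trans hab
  set M : ℝ := (b - a) ^ 2 with hM
  have hMpos : 0 < M := pow_pos (sub_pos.2 hab) 2
  -- The side `r` of the box is such that the covariance, averaged over a box, is at most `κ / 2`.
  obtain ⟨r₀, hr₀⟩ := exists_nat_ge (2 * M * (b * d / a + 1) / κ)
  set r : ℕ := r₀ + 1 with hr
  have hr1 : (1 : ℝ) ≤ r := by simp [hr]
  have hrκ : M * (b * d / a + 1) ≤ r * (κ / 2) := by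
    rw [div_le_iff₀ hκ] at hr₀
    have : (r : ℝ) = r₀ + 1 := by simp [hr]
    rw [this]
    nlinarith
  set B : Finset (Fin d → ℤ) := Fintype.piFinset fun _ => Finset.Ico (0 : ℤ) r with hB
  have hBcard : (B.card : ℝ) = (r : ℝ) ^ d := by simp [hB, Fintype.card_piFinset]
  have hB0 : (0 : Fin d → ℤ) ∈ B := by
    simp [hB, Fintype.mem_piFinset, hr]
  have hBpos : (0 : ℝ) < B.card := by rw [hBcard]; positivity
  set R : ℝ := b * (d * r) with hR
  have hR0 : 0 ≤ R := by positivity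
  have hBR : ∀ x ∈ B, ∀ y ∈ B, b * l1 (x - y) ≤ R := fun x hx y hy =>
    mul_le_mul_of_nonneg_left (l1_sub_le_of_mem_box hx hy) hb.le
  have havg : M * (R / a + 1) ≤ B.card * (κ / 2) := by
    rw [hBcard]
    calc M * (R / a + 1) ≤ M * ((b * d / a + 1) * r) := by
          refine mul_le_mul_of_nonneg_left ?_ hMpos.le
          have : R / a = b * d / a * r := by rw [hR]; ring
          rw [this]
          linarith
      _ = M * (b * d / a + 1) * r := by ring
      _ ≤ r * (κ / 2) * r := mul_le_mul_of_nonneg_right hrκ (by linarith)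
      _ = (r : ℝ) ^ 2 * (κ / 2) := by ring
      _ ≤ (r : ℝ) ^ d * (κ / 2) :=
          mul_le_mul_of_nonneg_right (pow_le_pow_right₀ hr1 hd) (by linarith)
  refine ⟨⌊M * (2 * R) ^ 2 / (κ / 2) ^ 2⌋₊, fun v S hS => Nat.le_floor ?_⟩
  set f : Edge d → ℝ := edgeCov G v with hf
  set g : (Fin d → ℤ) → Edge d → ℝ := fun x e => f e - f ((edgeTranslation x).symm e) with hg
  -- Bessel's inequality for `T(0, v) - T(x, x + v)`, which is at most `2 b |x|`.
  have hbessel : ∀ x ∈ B, ∑ e ∈ S, g x e ^ 2 ≤ M * (2 * R) ^ 2 := by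
    intro x hx
    have hD : Measurable fun t : Edge d → ℝ => passageTime t 0 v - passageTime t x (x + v) :=
      (measurable_passageTime 0 v).sub (measurable_passageTime x (x + v))
    have hK : ∀ᵐ t ∂(envMeasure d G),
        |passageTime t 0 v - passageTime t x (x + v)| ≤ 2 * R := by
      filter_upwards [ae_env hG] with t ht
      refine (abs_passageTime_sub_translate_le ha ht v x).trans ?_
      have := hBR x hx 0 hB0
      rw [sub_zero] at this
      linarith
    refine le_trans (le_of_eq ?_) (sum_sq_integral_mul_sub_mean_le hab hG hD hK S)
    refine Finset.sum_congr rfl fun e _ => ?_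
    simp_rw [sub_mul]
    rw [integral_sub (integrable_passageTime_mul ha hG 0 v e)
      (integrable_passageTime_mul ha hG x (x + v) e), integral_passageTime_translate_mul]
    rfl
  have hlow : ∀ e ∈ S, B.card * (κ / 2) ^ 2 ≤ ∑ x ∈ B, g x e ^ 2 := by
    intro e he
    have h1 : B.card * (κ / 2) ≤ ∑ x ∈ B, g x e := by
      have h2 := sum_edgeCov_translates_le ha hG v e hR0 hBR
      have h3 : (B.card : ℝ) * κ ≤ B.card * f e := mul_le_mul_of_nonneg_left (hS e he) hBpos.le
      simp only [hg, Finset.sum_sub_distrib, Finset.sum_const, nsmul_eq_mul]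
      linarith
    have h2 : (∑ x ∈ B, g x e) ^ 2 ≤ B.card * ∑ x ∈ B, g x e ^ 2 := sq_sum_le_card_mul_sum_sq
    have h3 : (B.card * (κ / 2)) ^ 2 ≤ (∑ x ∈ B, g x e) ^ 2 :=
      pow_le_pow_left₀ (by positivity) h1 2
    refine le_of_mul_le_mul_left ?_ hBpos
    calc _ = (B.card * (κ / 2)) ^ 2 := by ring
      _ ≤ _ := h3.trans h2
  rw [le_div_iff₀ (by positivity)]
  refine le_of_mul_le_mul_left ?_ hBpos
  calc (B.card : ℝ) * (S.card * (κ / 2) ^ 2) = ∑ _e ∈ S, B.card * (κ / 2) ^ 2 := by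
        rw [Finset.sum_const, nsmul_eq_mul]; ring
    _ ≤ ∑ e ∈ S, ∑ x ∈ B, g x e ^ 2 := Finset.sum_le_sum hlow
    _ = ∑ x ∈ B, ∑ e ∈ S, g x e ^ 2 := Finset.sum_comm
    _ ≤ ∑ _x ∈ B, M * (2 * R) ^ 2 := Finset.sum_le_sum hbessel
    _ = B.card * (M * (2 * R) ^ 2) := by rw [Finset.sum_const, nsmul_eq_mul]

/-- Since the law of the weights charges every neighbourhood of the left end `a` of the interval,
but not `a` itself, there are `q₁ < q₂` close to `a` such that a weight is rarely below `q₂` but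
has a positive probability of being below `q₁`. -/
lemma exists_quantiles [NullSingletonClass G] (hGab : G (Set.Icc a b)ᶜ = 0)
    (hpos : ∀ q, a < q → q ≤ b → 0 < G.real (Set.Iic q)) (hab : a < b) {δ : ℝ} (hδ : 0 < δ) :
    ∃ q₁ q₂ : ℝ, q₁ < q₂ ∧ 0 < G.real (Set.Iic q₁) ∧ G.real (Set.Iio q₂) ≤ δ := by
  have h0 : ProbabilityTheory.cdf G a = 0 := by
    rw [ProbabilityTheory.cdf_eq_real, Measure.real, ← Set.Iio_union_right, measure_union_null]
    · simp
    · exact measure_mono_null (fun x hx => fun h => not_le.2 hx h.1) hGab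
    · exact measure_singleton a
  have hcont : Filter.Tendsto (ProbabilityTheory.cdf G) (nhdsWithin a (Set.Ioi a)) (nhds 0) := by
    rw [← h0]
    exact ((ProbabilityTheory.cdf G).right_continuous a).mono Set.Ioi_subset_Ici_self
  obtain ⟨q₂, hq₂, hqb⟩ := ((hcont.eventually (gt_mem_nhds hδ)).and
    (Ioo_mem_nhdsGT hab)).exists
  refine ⟨(a + q₂) / 2, q₂, by linarith [hqb.1], hpos _ (by linarith [hqb.1])
    (by linarith [hqb.1, hqb.2]), ?_⟩
  rw [ProbabilityTheory.cdf_eq_real] at hq₂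
  exact (measureReal_mono Set.Iio_subset_Iic_self).trans hq₂.le

end Counting

lemma measureReal_Iic_pos {G : Measure ℝ} [IsProbabilityMeasure G] {a b α : ℝ} (hα : 0 < α)
    {ρ : ℝ → ENNReal} (hGρ : G = volume.withDensity ρ)
    (hρ : ∀ᵐ x : ℝ, x ∈ Set.Icc a b → ENNReal.ofReal α ≤ ρ x) {q : ℝ} (haq : a < q) (hqb : q ≤ b) :
    0 < G.real (Set.Iic q) := by
  refine ENNReal.toReal_pos ?_ (measure_ne_top _ _)
  have : ENNReal.ofReal α * volume (Set.Icc a q) ≤ G (Set.Iic q) := by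
    calc ENNReal.ofReal α * volume (Set.Icc a q) = ∫⁻ _x in Set.Icc a q, ENNReal.ofReal α := by
          rw [setLIntegral_const]
      _ ≤ ∫⁻ x in Set.Icc a q, ρ x := by
          refine setLIntegral_mono_ae' measurableSet_Icc ?_
          filter_upwards [hρ] with x hx hxq
          exact hx ⟨hxq.1, hxq.2.trans hqb⟩
      _ = G (Set.Icc a q) := by rw [hGρ, withDensity_apply _ measurableSet_Icc]
      _ ≤ G (Set.Iic q) := measure_mono Set.Icc_subset_Iic_self
  refine (lt_of_lt_of_le (ENNReal.mul_pos ?_ ?_) this).ne'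
  · simpa using hα
  · simpa using haq

end FPP

theorem theorem1p1 (d : ℕ) (hd : 2 ≤ d) (G : Measure ℝ) [IsProbabilityMeasure G]
    (hG : FPP.WeightAssumption G) :
    (∀ᵐ t ∂(FPP.envMeasure d G), ∀ u v : Fin d → ℤ,
      ∃! p : (FPP.lattice d).Walk u v, FPP.IsGeodesic t p) ∧
    ∀ ε : ℝ, 0 < ε → ∃ C : ℝ, 0 < C ∧ ∀ v : Fin d → ℤ,
      {e : FPP.Edge d |
        ε ≤ (FPP.envMeasure d G).real {t | e ∈ FPP.geodesicEdges t 0 v}}.Finite ∧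
      ({e : FPP.Edge d |
        ε ≤ (FPP.envMeasure d G).real {t | e ∈ FPP.geodesicEdges t 0 v}}.ncard : ℝ) ≤ C := by
  obtain ⟨a, b, α, ha, hab, hα, hGab, ρ, -, hGρ, hρ⟩ := hG
  have : NullSingletonClass G := by rw [hGρ]; infer_instance
  have hGae : ∀ᵐ x ∂G, x ∈ Set.Icc a b := mem_ae_iff.2 hGab
  refine ⟨FPP.ae_existsUnique_isGeodesic ha hGae, fun ε hε => ?_⟩
  obtain ⟨q₁, q₂, hq, hq₁, hq₂⟩ := FPP.exists_quantiles hGab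
    (fun q => FPP.measureReal_Iic_pos hα hGρ hρ) hab (half_pos hε)
  set c : ℝ := (q₂ - q₁) ^ 2 * G.real (Set.Iic q₁) / 2 with hc
  have hcpos : 0 < c := by
    have := sub_pos.2 hq
    positivity
  obtain ⟨N, hN⟩ := FPP.exists_card_le_of_le_edgeCov (G := G) hd ha hab hGae
    (κ := c * (ε / 2)) (by positivity)
  refine ⟨N + 1, by positivity, fun v => ?_⟩
  set A : Set (FPP.Edge d) :=
    {e | ε ≤ (FPP.envMeasure d G).real {t | e ∈ FPP.geodesicEdges t 0 v}} with hA
  have hcov : ∀ e ∈ A, c * (ε / 2) ≤ FPP.edgeCov G v e := fun e he =>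
    le_trans (mul_le_mul_of_nonneg_left (by
      have : ε ≤ (FPP.envMeasure d G).real {t | e ∈ FPP.geodesicEdges t 0 v} := he
      linarith) hcpos.le) (FPP.le_edgeCov ha hGae hq.le v e)
  have hfin : A.Finite := by
    by_contra hinf
    obtain ⟨S, hSA, hS⟩ := Set.Infinite.exists_subset_card_eq hinf (N + 1)
    have := hN v S fun e he => hcov e (hSA he)
    omega
  refine ⟨hfin, ?_⟩
  have := hN v hfin.toFinset fun e he => hcov e (hfin.mem_toFinset.1 he)
  rw [Set.ncard_eq_toFinset_card A hfin]
  have : (hfin.toFinset.card : ℝ) ≤ N := by exact_mod_cast this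
  linarith
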